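/- An epimorphism of a chain $(X,\le)$ is a surjective map $g:X\to X$ with $x\le y\Rightarrow g(x)\le g(y)$; the chain is automorphism-rigid if its only order-automorphism is the identity. Let $f$ be an epimorphism of $X$, and write $f^k$ for its $k$-th iterate. A map $g:X\to X$ is *generated from $f$ in a wide sense* if there are $a_0<a_1<a_2<\cdots$ in $X$ with $f(a_{n+1})=a_n$ for all $n\ge 0$ such that $g$ has one of the following two forms, where $s_n=k_0+\cdots+k_{n-1}$ (so $s_0=0$) and $[a_0,\sup_m a_m)$ denotes the set of $x\in X$ with $a_0\le x<a_m$ for some $m$. (Infinite form) There are $b_0<b_1<b_2<\cdots$ in $[a_0,\sup_m a_m)$ and integers $k_n\ge 1$ with $f^{k_n}(b_{2n+1})=b_{2n}$ for all $n\ge 0$, such that every $a_m$ is $\le f^{s_n}(b_{2n})$ for some $n$ (that is, $\sup_n f^{s_n}(b_{2n})=\sup_m a_m$), and $$g(x)=\begin{cases} f^{s_n}(b_{2n}) & \text{if } b_{2n}\le x\le b_{2n+1},\\ f^{s_{n+1}}(x) & \text{if } b_{2n+1}\le x\le b_{2n+2},\\ x & \text{if } x\notin\bigcup_{n}[b_n,b_{n+1}].\end{cases}$$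 (Finite form) There are $N\ge 0$, points $b_0<b_1<\cdots<b_{2N-1}$ in $[a_0,\sup_m a_m)$ and integers $k_0,\dots,k_{N-1}\ge 1$ with $f^{k_n}(b_{2n+1})=b_{2n}$ for $n<N$, such that $g$ is given by the same formulas for $0\le n<N$, with the last interval $[b_{2N-1},b_{2N}]$ replaced by $[b_{2N-1},\sup_m a_m)$, and $g(x)=x$ at all points outside these $2N$ intervals (so $g$ is the identity if $N=0$). Claim: there is a subset $X$ of $\mathbb R$, dense in $\mathbb R$ and of cardinality $2^{\aleph_0}$, such that $(X,\le)$ is automorphism-rigid, the map $$f(x)=\begin{cases} x & \text{if } x\le 0,\\ 0 & \text{if } 0\le x\le 1,\\ x-1 & \text{if } x>1\end{cases}$$ maps $X$ to $X$ and is a non-identity epimorphism of $(X,\le)$, and every epimorphism of $(X,\le)$ is generated from $f$ in a wide sense. -/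

import Mathlib

namespace SurjRigid

/-- An epimorphism of the chain `(X, ≤)`: a surjective map from `X` to `X` preserving `≤`. -/
def IsEpi {X : Type*} [LinearOrder X] (f : X → X) : Prop :=
  Monotone f ∧ Function.Surjective f

/-- A chain is automorphism-rigid if its only order-automorphism is the identity. -/
def AutRigid (X : Type*) [LinearOrder X] : Prop :=
  ∀ e : X ≃o X, e = OrderIso.refl X

/-- The map of the real line which is the identity on `(-∞, 0]`, collapses `[0, 1]` to `0`, and is
`x ↦ x - 1` on `[1, ∞)`. -/
noncomputable def collapse (x : ℝ) : ℝ :=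
  if x ≤ 0 then x else if x ≤ 1 then 0 else x - 1

/-- A strictly increasing sequence `a 0 < a 1 < a 2 < …` with `f (a (n + 1)) = a n` for all `n`. -/
def IsBackwardOrbit {X : Type*} [LinearOrder X] (f : X → X) (a : ℕ → X) : Prop :=
  StrictMono a ∧ ∀ n, f (a (n + 1)) = a n

/-- The infinite form of a map generated from `f` in a wide sense.  There are
`b 0 < b 1 < b 2 < …` in `[a 0, sup a)` and integers `k n ≥ 1` with
`f^(k n) (b (2n+1)) = b (2n)`; writing `s n = k 0 + ⋯ + k (n-1)`, the map `g`
* fixes every point outside all the intervals `[b n, b (n+1)]`,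
* is constant with value `f^(s n) (b (2n))` on `[b (2n), b (2n+1)]`,
* is `f^(s (n+1))` on `[b (2n+1), b (2n+2)]`.
The supremum of the values `f^(s n) (b (2n))` is that of the `a m`: since `a` is strictly
increasing and these values are bounded by the `b (2n)`, this says that each `a m` lies below
one of them. -/
def IsWideInfinite {X : Type*} [LinearOrder X] (f : X → X) (a : ℕ → X) (g : X → X) : Prop :=
  ∃ (b : ℕ → X) (k : ℕ → ℕ),
    StrictMono b ∧
    (∀ n, a 0 ≤ b n ∧ ∃ m, b n < a m) ∧
    (∀ n, 1 ≤ k n ∧ f^[k n] (b (2 * n + 1)) = b (2 * n)) ∧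
    (∀ m, ∃ n, a m ≤ f^[∑ i ∈ Finset.range n, k i] (b (2 * n))) ∧
    (∀ x, (∀ n, x ∉ Set.Icc (b n) (b (n + 1))) → g x = x) ∧
    (∀ n, ∀ x ∈ Set.Icc (b (2 * n)) (b (2 * n + 1)),
      g x = f^[∑ i ∈ Finset.range n, k i] (b (2 * n))) ∧
    (∀ n, ∀ x ∈ Set.Icc (b (2 * n + 1)) (b (2 * n + 2)),
      g x = f^[∑ i ∈ Finset.range (n + 1), k i] x)

/-- The `n`-th of the `2N` intervals of the finite form: `[b n, b (n+1)]` for `n + 1 < 2N`, and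
`[b (2N-1), sup a)` for the last one.  (The right end `b (2N) = sup a` may be `∞` or a gap of `X`;
if it is a point of `X`, then every epimorphism `f` having `a` as a backward orbit fixes it.) -/
def finPiece {X : Type*} [LinearOrder X] (a b : ℕ → X) (N n : ℕ) : Set X :=
  {x | b n ≤ x ∧ if n + 1 < 2 * N then x ≤ b (n + 1) else ∃ m, x < a m}

/-- The finite form of a map generated from `f` in a wide sense: as in the infinite form, but with
`b 0 < b 1 < ⋯ < b (2N-1) < b (2N) = sup a`, only the values `b 0, …, b (2N-1)` and
`k 0, …, k (N-1)` being used.  For `N = 0` this is the identity map. -/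
def IsWideFinite {X : Type*} [LinearOrder X] (f : X → X) (a : ℕ → X) (g : X → X) : Prop :=
  ∃ (N : ℕ) (b : ℕ → X) (k : ℕ → ℕ),
    (∀ i j, i < j → j < 2 * N → b i < b j) ∧
    (∀ n < 2 * N, a 0 ≤ b n ∧ ∃ m, b n < a m) ∧
    (∀ n < N, 1 ≤ k n ∧ f^[k n] (b (2 * n + 1)) = b (2 * n)) ∧
    (∀ x, (∀ n < 2 * N, x ∉ finPiece a b N n) → g x = x) ∧
    (∀ n < N, ∀ x ∈ finPiece a b N (2 * n),
      g x = f^[∑ i ∈ Finset.range n, k i] (b (2 * n))) ∧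
    (∀ n < N, ∀ x ∈ finPiece a b N (2 * n + 1),
      g x = f^[∑ i ∈ Finset.range (n + 1), k i] x)

/-- `g` is generated from `f` in a wide sense. -/
def GeneratedWide {X : Type*} [LinearOrder X] (f g : X → X) : Prop :=
  ∃ a : ℕ → X, IsBackwardOrbit f a ∧ (IsWideInfinite f a g ∨ IsWideFinite f a g)

end SurjRigid

namespace SurjRigid

open Cardinal Set

/-! Put two reals in one class when `rep` agrees on them: a negative real is alone in its class, and
nonnegative reals are classed modulo 1. Transfinite diagonalization against the continuous maps of
the line, at most 𝔠 in number, gives a union `X` of classes, containing ℚ, such that every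
continuous map preserving `X` is class-rigid (`exists_rigid_set`).

An epimorphism of `X` extends to a continuous monotone `h` on ℝ. Call `x - h x` the drop. Where the
drop is not an integer, `h` is locally constant, so the drop can never decrease
(`IsClassRigid.monotone_sub`). On `(-∞, 0]` singleton classes force `h x = x`. To the right of 0,
`h` alternates between translations by integers and constant pieces of integer length
(`IsClassRigid.exists_step`, `IsClassRigid.exists_breakpoints`). The ends of these pieces lie in `X`
and serve as the `b n`. An automorphism allows no constant piece, hence is the identity. -/

/-! ### Classes modulo the relation generated by `collapse`. -/

/-- A representative of the class of `x` under the relation generated by the map `collapse`: points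
of `(-∞, 0]` represent themselves, positive reals are represented by their fractional part. -/
noncomputable def rep (x : ℝ) : ℝ := if x ≤ 0 then x else Int.fract x

theorem rep_of_nonpos {x : ℝ} (h : x ≤ 0) : rep x = x := if_pos h

theorem rep_of_nonneg {x : ℝ} (h : 0 ≤ x) : rep x = Int.fract x := by
  rcases h.eq_or_lt with rfl | h
  · simp [rep]
  · simp [rep, not_le.2 h]

theorem rep_eq_sub_intCast (x : ℝ) : ∃ z : ℤ, rep x = x - z := by
  rcases le_total x 0 with h | h
  · exact ⟨0, by simp [rep_of_nonpos h]⟩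
  · exact ⟨⌊x⌋, by rw [rep_of_nonneg h]; rfl⟩

theorem rep_rep (x : ℝ) : rep (rep x) = rep x := by
  rcases le_total x 0 with h | h
  · simp [rep_of_nonpos h]
  · rw [rep_of_nonneg h, rep_of_nonneg (Int.fract_nonneg x), Int.fract_fract]

theorem rep_eq_rep {x y : ℝ} (h : rep x = rep y) :
    x = y ∨ (0 ≤ x ∧ 0 ≤ y ∧ ∃ z : ℤ, y - x = z) := by
  rcases le_total x 0 with hx | hx <;> rcases le_total y 0 with hy | hy
  · rw [rep_of_nonpos hx, rep_of_nonpos hy] at h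
    exact Or.inl h
  · rw [rep_of_nonpos hx, rep_of_nonneg hy] at h
    have h0 := Int.fract_nonneg y
    have : x = 0 := le_antisymm hx (h ▸ h0)
    refine Or.inr ⟨this.ge, hy, ⌊y⌋, ?_⟩
    rw [← Int.self_sub_floor] at h
    linarith
  · rw [rep_of_nonneg hx, rep_of_nonpos hy] at h
    have h0 := Int.fract_nonneg x
    have : y = 0 := le_antisymm hy (h ▸ h0)
    refine Or.inr ⟨hx, this.ge, -⌊x⌋, ?_⟩
    rw [← Int.self_sub_floor] at h
    push_cast
    linarith
  · rw [rep_of_nonneg hx, rep_of_nonneg hy] at h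
    exact Or.inr ⟨hx, hy, Int.fract_eq_fract.1 h.symm⟩

theorem rep_eq_rep_of_sub_eq {x y : ℝ} (hx : 0 ≤ x) (hy : 0 ≤ y) (z : ℤ) (h : y - x = z) :
    rep x = rep y := by
  rw [rep_of_nonneg hx, rep_of_nonneg hy]
  exact (Int.fract_eq_fract.2 ⟨z, h⟩).symm

theorem rep_collapse (x : ℝ) : rep (collapse x) = rep x ∨ (0 ≤ x ∧ x ≤ 1 ∧ collapse x = 0) := by
  unfold collapse
  split_ifs with h0 h1
  · exact Or.inl rfl
  · exact Or.inr ⟨(not_le.1 h0).le, h1, rfl⟩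
  · push Not at h0 h1
    exact Or.inl (rep_eq_rep_of_sub_eq (by linarith) h0.le 1 (by push_cast; ring))

/-- Each class is countable, since `rep` changes a real by an integer. -/
theorem mk_preimage_rep_lt {C : Set ℝ} (hC : #C < 𝔠) : #(rep ⁻¹' C) < 𝔠 := by
  have hsub : rep ⁻¹' C ⊆ range fun p : C × ℤ => (p.1 : ℝ) + p.2 := by
    intro x hx
    obtain ⟨z, hz⟩ := rep_eq_sub_intCast x
    exact ⟨(⟨rep x, hx⟩, z), by simp [hz]⟩
  refine ((mk_le_mk_of_subset hsub).trans mk_range_le).trans_lt ?_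
  rw [mk_prod, lift_id, lift_id]
  exact mul_lt_of_lt aleph0_le_continuum hC (by simpa using aleph0_lt_continuum)

/-! ### Diagonal construction of the set `X`. -/

/-- `h` is constant on every interval on which it moves each point to another class. -/
def IsClassRigid (h : ℝ → ℝ) : Prop :=
  ∀ x y, x < y → (∀ t ∈ Icc x y, rep (h t) ≠ rep t) → h x = h y

/-- On an interval witnessing the failure of rigidity, `h` takes 𝔠 values by the intermediate value
theorem, while fewer than 𝔠 of them are spoiled by `C`. -/
theorem exists_rep_notMem {h : ℝ → ℝ} (hc : Continuous h) (hr : ¬ IsClassRigid h) {C : Set ℝ}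
    (hC : #C < 𝔠) : ∃ x, rep (h x) ≠ rep x ∧ rep x ∉ C ∧ rep (h x) ∉ C := by
  unfold IsClassRigid at hr
  push Not at hr
  obtain ⟨x, y, hxy, hne, hh⟩ := hr
  have hB := mk_preimage_rep_lt hC
  have hsmall : #(rep ⁻¹' C ∪ h '' (rep ⁻¹' C) : Set ℝ) < 𝔠 :=
    (mk_union_le _ _).trans_lt
      (add_lt_of_lt aleph0_le_continuum hB (mk_image_le.trans_lt hB))
  have hbig : #(uIcc (h x) (h y)) = 𝔠 := mk_Icc_real (by simpa [eq_comm] using hh)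
  have hnot : ¬ uIcc (h x) (h y) ⊆ rep ⁻¹' C ∪ h '' (rep ⁻¹' C) := fun hs =>
    (hbig ▸ hsmall).not_ge (mk_le_mk_of_subset hs)
  obtain ⟨v, hv, hvC⟩ := not_subset.1 hnot
  obtain ⟨t, ht, rfl⟩ := intermediate_value_uIcc hc.continuousOn hv
  rw [uIcc_of_le hxy.le] at ht
  exact ⟨t, hne t ht, fun h' => hvC (Or.inr ⟨t, h', rfl⟩), fun h' => hvC (Or.inl h')⟩

/-- Continuum many tasks, each of which can be met by a pair of reals avoiding any given set of
fewer than continuum many reals, can be met simultaneously by disjoint families. -/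
theorem exists_diagonal (P : (ord continuum.{0}).ToType → ℝ → ℝ → Prop)
    (hne : ∀ i u v, P i u v → u ≠ v)
    (hP : ∀ i (C : Set ℝ), #C < 𝔠 → ∃ u v, P i u v ∧ u ∉ C ∧ v ∉ C) :
    ∃ u v : (ord continuum.{0}).ToType → ℝ, (∀ i, P i (u i) (v i)) ∧ Function.Injective u ∧
      ∀ i j, u i ≠ v j := by
  choose! p q hpq using hP
  let F : (ord continuum.{0}).ToType → ℝ × ℝ := wellFounded_lt.fix fun i r =>
    (p i {x | ∃ j, ∃ h : j < i, x = (r j h).1 ∨ x = (r j h).2},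
      q i {x | ∃ j, ∃ h : j < i, x = (r j h).1 ∨ x = (r j h).2})
  -- The values chosen before stage `i`; fewer than 𝔠, because proper initial segments of the
  -- initial ordinal of 𝔠 are smaller than 𝔠.
  let C : (ord continuum.{0}).ToType → Set ℝ := fun i => {x | ∃ j, ∃ _ : j < i, x = (F j).1 ∨ x = (F j).2}
  have hF : ∀ i, F i = (p i (C i), q i (C i)) := fun i => wellFounded_lt.fix_eq _ i
  have hC : ∀ i, #(C i) < 𝔠 := by
    intro i
    have hs : C i ⊆ (fun j => (F j).1) '' Iio i ∪ (fun j => (F j).2) '' Iio i := by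
      rintro x ⟨j, hj, rfl | rfl⟩
      · exact Or.inl ⟨j, hj, rfl⟩
      · exact Or.inr ⟨j, hj, rfl⟩
    have hi : #(Iio i) < 𝔠 := by simpa using mk_Iio_lt i
    exact (mk_le_mk_of_subset hs).trans_lt ((mk_union_le _ _).trans_lt
      (add_lt_of_lt aleph0_le_continuum (mk_image_le.trans_lt hi) (mk_image_le.trans_lt hi)))
  have h1 : ∀ i, P i (F i).1 (F i).2 := fun i => by rw [hF]; exact (hpq i _ (hC i)).1
  have h2 : ∀ i, (F i).1 ∉ C i := fun i => by rw [hF]; exact (hpq i _ (hC i)).2.1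
  have h3 : ∀ i, (F i).2 ∉ C i := fun i => by rw [hF]; exact (hpq i _ (hC i)).2.2
  refine ⟨fun i => (F i).1, fun i => (F i).2, h1, fun i j hij => ?_, fun i j hij => ?_⟩
  · dsimp only at hij
    rcases lt_trichotomy i j with h | h | h
    · exact (h2 j ⟨i, h, Or.inl hij.symm⟩).elim
    · exact h
    · exact (h2 i ⟨j, h, Or.inl hij⟩).elim
  · rcases lt_trichotomy i j with h | rfl | h
    · exact h3 j ⟨i, h, Or.inl hij.symm⟩
    · exact hne i _ _ (h1 i) hij
    · exact h2 i ⟨j, h, Or.inr hij⟩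

theorem mk_continuous_real_le : #{h : ℝ → ℝ // Continuous h} ≤ 𝔠 := by
  have hinj : Function.Injective
      fun (h : {h : ℝ → ℝ // Continuous h}) (q : ℚ) => h.1 (q : ℝ) := by
    intro h₁ h₂ e
    refine Subtype.ext (Rat.denseRange_cast.equalizer h₁.2 h₂.2 ?_)
    exact e
  refine (mk_le_of_injective hinj).trans ?_
  simp [mk_real]

theorem not_isClassRigid_sub_one : ¬ IsClassRigid fun x => x - 1 := by
  intro h
  have := h (-2) (-1) (by norm_num) fun t ht e => by
    dsimp only at e
    rw [rep_of_nonpos (by linarith [ht.2]), rep_of_nonpos (by linarith [ht.2])] at e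
    linarith
  norm_num at this

/-- There is a set of reals, saturated for the relation generated by `collapse`, such that any
continuous map of the real line preserving it is constant on every interval on which it moves each
point to another class. -/
theorem exists_rigid_set : ∃ X : Set ℝ, (∀ x y, rep x = rep y → x ∈ X → y ∈ X) ∧
    (∀ q : ℚ, (q : ℝ) ∈ X) ∧ #X = 𝔠 ∧
    ∀ h : ℝ → ℝ, Continuous h → (∀ x ∈ X, h x ∈ X) → IsClassRigid h := by
  let B := {h : ℝ → ℝ // Continuous h ∧ ¬ IsClassRigid h}
  have hB : #B ≤ #((ord continuum.{0}).ToType) := by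
    rw [mk_ord_toType]
    exact (mk_subtype_mono fun h hh => hh.1).trans mk_continuous_real_le
  obtain ⟨φ⟩ := Cardinal.le_def _ _ |>.1 hB
  have : Nonempty B := ⟨⟨fun x => x - 1, by fun_prop, not_isClassRigid_sub_one⟩⟩
  obtain ⟨H, hH⟩ : ∃ H : (ord continuum.{0}).ToType → B, Function.Surjective H :=
    ⟨Function.invFun φ, Function.invFun_surjective φ.injective⟩
  -- Stage `i` keeps the class of `x` in `X` and expels that of its image under `H i`, so `H i` does
  -- not preserve `X`. Expelled representatives are irrational, which keeps ℚ inside `X`.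
  obtain ⟨u, v, hP, hu, huv⟩ := exists_diagonal
    (fun i a b => a ≠ b ∧ ∃ x, a = rep x ∧ b = rep ((H i).1 x) ∧ ∀ q : ℚ, (q : ℝ) ≠ b)
    (fun i a b h => h.1) (fun i C hC => by
      have hC' : #(C ∪ range ((↑) : ℚ → ℝ) : Set ℝ) < 𝔠 :=
        (mk_union_le _ _).trans_lt (add_lt_of_lt aleph0_le_continuum hC
          (mk_range_le.trans_lt (by simpa using aleph0_lt_continuum)))
      obtain ⟨x, hx, h1, h2⟩ := exists_rep_notMem (H i).2.1 (H i).2.2 hC'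
      exact ⟨rep x, rep ((H i).1 x), ⟨hx.symm, x, rfl, rfl, fun q hq => h2 (Or.inr ⟨q, hq⟩)⟩,
        fun h => h1 (Or.inl h), fun h => h2 (Or.inl h)⟩)
  refine ⟨{x | rep x ∉ range v}, fun x y e hx => ?_, fun q => ?_, ?_, fun h hc hX => ?_⟩
  · simpa [← e] using hx
  · rintro ⟨i, hi⟩
    obtain ⟨z, hz⟩ := rep_eq_sub_intCast q
    obtain ⟨-, x, -, -, hq⟩ := hP i
    exact hq (q - z) (by rw [hi, hz]; push_cast; rfl)
  · refine le_antisymm ((mk_set_le _).trans mk_real.le) ?_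
    have hmem : ∀ i, u i ∈ {x | rep x ∉ range v} := by
      rintro i ⟨j, hj⟩
      obtain ⟨-, x, hx, -⟩ := hP i
      rw [hx, rep_rep, ← hx] at hj
      exact huv i j hj.symm
    have := mk_le_of_injective (f := fun i => (⟨u i, hmem i⟩ : {x | rep x ∉ range v}))
      fun i j e => hu (congrArg Subtype.val e)
    rwa [mk_ord_toType] at this
  · by_contra hr
    obtain ⟨i, hi⟩ := hH ⟨h, hc, hr⟩
    obtain ⟨-, x, hx, hy, -⟩ := hP i
    rw [hi] at hy
    refine hX x ?_ ⟨i, hy⟩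
    rintro ⟨j, hj⟩
    exact huv i j (hx.trans hj.symm)

/-! ### The shape of class-rigid monotone maps. -/

section ClassRigid

variable {h : ℝ → ℝ}

theorem IsClassRigid.eq_of_sub_ne_intCast (hr : IsClassRigid h) {x y : ℝ} (hxy : x < y)
    (hne : ∀ t ∈ Icc x y, ∀ z : ℤ, t - h t ≠ z) : h x = h y := by
  refine hr x y hxy fun t ht e => ?_
  rcases rep_eq_rep e with e | ⟨-, -, z, hz⟩
  · exact hne t ht 0 (by simp [e])
  · exact hne t ht z hz

theorem IsClassRigid.exists_gt_eq (hr : IsClassRigid h) (hc : Continuous h) {x : ℝ}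
    (hx : ∀ z : ℤ, x - h x ≠ z) : ∃ y, x < y ∧ h x = h y := by
  have hopen : IsOpen {t : ℝ | t - h t ∈ (range ((↑) : ℤ → ℝ))ᶜ} :=
    Int.isClosedEmbedding_coe_real.isClosed_range.isOpen_compl.preimage (by fun_prop)
  have hmem : x ∈ {t : ℝ | t - h t ∈ (range ((↑) : ℤ → ℝ))ᶜ} := by
    rintro ⟨z, hz⟩
    exact hx z hz.symm
  obtain ⟨ε, hε, hball⟩ := Metric.isOpen_iff.1 hopen x hmem
  refine ⟨x + ε / 2, by linarith, hr.eq_of_sub_ne_intCast (by linarith) fun t ht z hz => ?_⟩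
  have hmem' : t ∈ Metric.ball x ε := by
    rw [Metric.mem_ball, Real.dist_eq, abs_of_nonneg (by linarith [ht.1])]
    linarith [ht.2]
  exact hball hmem' ⟨z, hz.symm⟩

/-- If the drop fell, it would cross an irrational level `c`. At the last point where it is at least
`c` it equals `c`, so `h` is constant just to the right and the drop grows there, a contradiction.
-/
theorem IsClassRigid.monotone_sub (hr : IsClassRigid h) (hc : Continuous h) (hm : Monotone h) :
    Monotone fun x => x - h x := by
  intro x y hxy
  by_contra hlt
  dsimp only at hlt
  push Not at hlt
  obtain ⟨c, hirr, hc1, hc2⟩ := exists_irrational_btwn hlt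
  have hcomp : IsCompact (Icc x y ∩ {t | c ≤ t - h t}) :=
    isCompact_Icc.inter_right (isClosed_le continuous_const (by fun_prop))
  obtain ⟨t, ⟨ht, htc⟩, hmax⟩ := hcomp.exists_isGreatest ⟨x, ⟨le_rfl, hxy⟩, hc2.le⟩
  have hty : t < y := lt_of_le_of_ne ht.2 (by rintro rfl; exact absurd htc (not_le.2 hc1))
  have htc' : t - h t = c := by
    refine le_antisymm ?_ htc
    by_contra hgt
    push Not at hgt
    obtain ⟨s, hs, hsc⟩ := intermediate_value_Icc' (f := fun t => t - h t) hty.le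
      (by fun_prop) ⟨hc1.le, hgt.le⟩
    dsimp only at hsc
    have : s ≤ t := hmax ⟨⟨ht.1.trans hs.1, hs.2⟩, hsc.ge⟩
    rw [le_antisymm this hs.1] at hsc
    exact hgt.ne hsc.symm
  obtain ⟨u, htu, hu⟩ := hr.exists_gt_eq hc fun z hz => hirr ⟨z, by rw [← htc', hz]; simp⟩
  have hmin : h (min u y) = h t :=
    le_antisymm (hu ▸ hm (min_le_left _ _)) (hm (lt_min htu hty).le)
  have hlt' : t < min u y := lt_min htu hty
  have : min u y ≤ t := hmax ⟨⟨ht.1.trans hlt'.le, min_le_right _ _⟩, by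
    rw [mem_ofPred_eq, hmin]; linarith⟩
  exact this.not_gt hlt'

/-- A point with `x < h x` forces `t < h t` for all `t ≤ x`. Negative classes are singletons, so `h`
would be constant far to the left, yet it is unbounded below. -/
theorem IsClassRigid.le_self (hr : IsClassRigid h) (hc : Continuous h) (hm : Monotone h)
    (hbot : ∀ y, ∃ x, h x < y) (x : ℝ) : h x ≤ x := by
  by_contra hlt
  push Not at hlt
  have key : ∀ t ≤ min x (-1), t < h t := fun t ht => by
    have := hr.monotone_sub hc hm (ht.trans (min_le_left _ _))
    dsimp only at this
    linarith
  obtain ⟨y, hy⟩ := hbot (h (min x (-1)))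
  have hyx : y < min x (-1) := lt_of_not_ge fun hge => hy.not_ge (hm hge)
  refine hy.ne (hr y _ hyx fun t ht e => ?_)
  have h1 := key t ht.2
  have h2 := ht.2.trans (min_le_right x (-1))
  rcases rep_eq_rep e with e | ⟨-, h0, -⟩ <;> linarith

theorem IsClassRigid.eq_self (hr : IsClassRigid h) (hc : Continuous h) (hm : Monotone h)
    (hbot : ∀ y, ∃ x, h x < y) (htop : ∀ y, ∃ x, y < h x) {x : ℝ} (hx : x ≤ 0) : h x = x := by
  refine le_antisymm (hr.le_self hc hm hbot x) ?_
  by_contra hlt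
  push Not at hlt
  obtain ⟨y, hy⟩ := htop 0
  have hxy : x ≤ y := le_of_not_gt fun hlt' => by linarith [hm hlt'.le]
  -- The value `h x / 2` is negative and exceeds `h x`. On `[x, z]` the drop stays positive and `h`
  -- negative, so every point changes class and `h` must be constant.
  obtain ⟨z, hz, hhz⟩ := intermediate_value_Icc hxy hc.continuousOn
    (show h x / 2 ∈ Icc (h x) (h y) by constructor <;> linarith)
  have hxz : x < z := lt_of_le_of_ne hz.1 (by rintro rfl; linarith)
  have := hr x z hxz fun t ht e => by
    have h1 := hr.monotone_sub hc hm ht.1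
    have h2 := hm ht.2
    dsimp only at h1
    rcases rep_eq_rep e with e | ⟨h0, -⟩ <;> linarith
  linarith

/-- If `h` is the translation by `-k` at `p` but not everywhere to the right of `p`, then it is
this translation up to some `q`, constant on some `[q, q + j]` and larger beyond. -/
theorem IsClassRigid.exists_step (hr : IsClassRigid h) (hc : Continuous h) (hm : Monotone h)
    (htop : ∀ y, ∃ x, y < h x) {p : ℝ} {k : ℕ} (hp : p - h p = k)
    (hex : ∃ x, (k : ℝ) < x - h x) :
    ∃ (q : ℝ) (j : ℕ), p ≤ q ∧ 1 ≤ j ∧ (∀ x ∈ Icc p q, x - h x = k) ∧ h (q + j) = h q ∧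
      (∀ x > q + j, h (q + j) < h x) ∧ ((∀ x > p, h p < h x) → p < q) := by
  have hd := hr.monotone_sub hc hm
  obtain ⟨x₀, hx₀⟩ := hex
  let S : Set ℝ := {x | x - h x ≤ k}
  have hpS : p ∈ S := hp.le
  have hSb : BddAbove S := ⟨x₀, fun x hx => le_of_not_gt fun hlt =>
    (hx₀.trans_le (hd hlt.le)).not_ge hx⟩
  have hSc : IsClosed S := isClosed_le (by fun_prop) continuous_const
  have hqS := hSc.csSup_mem ⟨p, hpS⟩ hSb
  set q := sSup S
  have hpq : p ≤ q := le_csSup hSb hpS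
  have hqk : q - h q = k := le_antisymm hqS (hp ▸ hd hpq)
  have hgt : ∀ x > q, (k : ℝ) < x - h x := fun x hx => lt_of_not_ge fun hle =>
    hx.not_ge (le_csSup hSb hle)
  let T : Set ℝ := {x | h x ≤ h q}
  obtain ⟨x₁, hx₁⟩ := htop (h q)
  have hTb : BddAbove T := ⟨x₁, fun x hx => le_of_not_gt fun hlt =>
    (hx₁.trans_le (hm hlt.le)).not_ge hx⟩
  have hTc : IsClosed T := isClosed_le hc continuous_const
  have hqT : q ∈ T := le_refl (h q)
  have heT := hTc.csSup_mem ⟨q, hqT⟩ hTb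
  set e := sSup T
  have hqe : q ≤ e := le_csSup hTb hqT
  have hhe : h e = h q := le_antisymm heT (hm hqe)
  have hlt : q < e := by
    have hopen : IsOpen {x | x - h x < k + 1} := isOpen_lt (by fun_prop) continuous_const
    obtain ⟨ε, hε, hball⟩ := Metric.isOpen_iff.1 hopen q (by rw [mem_ofPred_eq, hqk]; linarith)
    have hsmall : ∀ t, q ≤ t → t ≤ q + ε / 2 → t - h t < k + 1 := fun t h1 h2 => by
      have hmem : t ∈ Metric.ball q ε := by
        rw [Metric.mem_ball, Real.dist_eq, abs_of_nonneg (by linarith)]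
        linarith
      exact hball hmem
    have hy : h (q + ε / 2) = h q := by
      by_contra hne
      have hlt : h q < h (q + ε / 2) := lt_of_le_of_ne (hm (by linarith)) (Ne.symm hne)
      -- At `q` itself the drop is the integer `k`, so rigidity is applied from a point `x > q`,
      -- where the drop lies strictly between `k` and `k + 1`.
      obtain ⟨x, hx, hhx⟩ := intermediate_value_Ioo (by linarith) hc.continuousOn
        (show (h q + h (q + ε / 2)) / 2 ∈ Ioo (h q) (h (q + ε / 2)) by constructor <;> linarith)
      have := hr.eq_of_sub_ne_intCast hx.2 fun t ht z hz => by
        have h1 := hgt t (hx.1.trans_le ht.1)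
        have h2 := hsmall t (hx.1.le.trans ht.1) ht.2
        rw [hz] at h1 h2
        norm_cast at h1 h2
        omega
      linarith
    have : q + ε / 2 ≤ e := le_csSup hTb hy.le
    linarith
  have hge : ∀ x > e, h e < h x := fun x hx => lt_of_not_ge fun hle =>
    hx.not_ge (le_csSup hTb (show h x ≤ h q from hhe ▸ hle))
  -- A non-integral drop at `e` would let the constant piece continue past `e`.
  obtain ⟨z, hz⟩ : ∃ z : ℤ, e - h e = z := by
    by_contra hne
    push Not at hne
    obtain ⟨y, hy, hey⟩ := hr.exists_gt_eq hc hne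
    exact (hge y hy).ne hey
  have hzk : (k : ℝ) < z := by rw [← hz]; exact hgt e hlt
  obtain ⟨j, hj⟩ := Int.eq_ofNat_of_zero_le (a := z - k) (by
    have : (k : ℤ) < z := by exact_mod_cast hzk
    omega)
  have hj' : (z : ℝ) - k = j := by exact_mod_cast hj
  have hej : q + j = e := by linarith
  refine ⟨q, j, hpq, ?_, fun x hx => le_antisymm (hqk ▸ hd hx.2) (hp ▸ hd hx.1), ?_, ?_,
    fun hinc => ?_⟩
  · have : (0 : ℝ) < j := by linarith
    exact_mod_cast this
  · rw [hej, hhe]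
  · rwa [hej]
  · refine lt_of_le_of_ne hpq fun hpq' => ?_
    have := hinc e (hpq'.trans_lt hlt)
    rw [hhe, hpq'] at this
    exact this.false

end ClassRigid

/-- Iterates `exists_step` from 0 as long as the drop still grows. For `0 < n` the point `e n` ends
a maximal constant piece, whence `e n < q n`; at `n = 0` equality may occur. -/
theorem IsClassRigid.exists_breakpoints {h : ℝ → ℝ} (hr : IsClassRigid h) (hc : Continuous h)
    (hm : Monotone h) (htop : ∀ y, ∃ x, y < h x) (h0 : h 0 = 0) :
    ∃ (q e : ℕ → ℝ) (k : ℕ → ℕ), e 0 = 0 ∧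
      ∀ n, (∀ m < n, ∃ x, e m - h (e m) < x - h x) →
        e n - h (e n) = (∑ i ∈ Finset.range n, k i : ℕ) ∧
        ((∃ x, e n - h (e n) < x - h x) →
          e n ≤ q n ∧ (0 < n → e n < q n) ∧ 1 ≤ k n ∧ e (n + 1) = q n + k n ∧
          (∀ x ∈ Icc (e n) (q n), x - h x = (∑ i ∈ Finset.range n, k i : ℕ)) ∧
          ∀ x ∈ Icc (q n) (e (n + 1)), h x = h (q n)) := by
  have step : ∀ p : ℝ, ∃ (q : ℝ) (j : ℕ), (∃ k : ℕ, p - h p = k) →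
      (∃ x, p - h p < x - h x) →
      p ≤ q ∧ 1 ≤ j ∧ (∀ x ∈ Icc p q, x - h x = p - h p) ∧ h (q + j) = h q ∧
      (∀ x > q + j, h (q + j) < h x) ∧ ((∀ x > p, h p < h x) → p < q) := by
    intro p
    by_cases hp : (∃ k : ℕ, p - h p = k) ∧ ∃ x, p - h p < x - h x
    · obtain ⟨⟨k, hk⟩, hx⟩ := hp
      obtain ⟨q, j, hq⟩ := hr.exists_step hc hm htop hk (hk ▸ hx)
      exact ⟨q, j, fun _ _ => by rwa [hk]⟩
    · exact ⟨0, 0, fun h1 h2 => (hp ⟨h1, h2⟩).elim⟩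
  choose Q J hQ using step
  let e : ℕ → ℝ := fun n => Nat.rec 0 (fun _ p => Q p + J p) n
  have hsucc : ∀ n, e (n + 1) = Q (e n) + J (e n) := fun n => rfl
  have hval : ∀ n, (∀ m < n, ∃ x, e m - h (e m) < x - h x) →
      e n - h (e n) = (∑ i ∈ Finset.range n, J (e i) : ℕ) := by
    intro n
    induction n with
    | zero => intro _; simp [e, h0]
    | succ n ih =>
      intro hn
      have ih := ih fun m hmn => hn m (by omega)
      obtain ⟨h1, -, h3, h4, -⟩ := hQ (e n) ⟨_, ih⟩ (hn n (by omega))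
      have h3 := h3 _ ⟨h1, le_rfl⟩
      rw [hsucc, h4, Finset.sum_range_succ]
      push_cast at ih ⊢
      linarith
  refine ⟨fun n => Q (e n), e, fun n => J (e n), rfl, fun n hn => ⟨hval n hn, fun hex => ?_⟩⟩
  have hv := hval n hn
  obtain ⟨h1, h2, h3, h4, -, h6⟩ := hQ (e n) ⟨_, hv⟩ hex
  refine ⟨h1, fun hpos => h6 ?_, h2, hsucc n, fun x hx => (h3 x hx).trans hv, fun x hx => ?_⟩
  · obtain ⟨m, rfl⟩ : ∃ m, n = m + 1 := ⟨n - 1, by omega⟩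
    exact (hQ (e m) ⟨_, hval m fun i hi => hn i (by omega)⟩ (hn m (by omega))).2.2.2.2.1
  · exact le_antisymm (h4 ▸ hm hx.2) (hm hx.1)

/-! ### Extension of epimorphisms to the line. -/

/-- A surjective monotone self-map of a dense set of reals extends to the real line. -/
theorem exists_continuous_extension {X : Set ℝ} (hX : Dense X) {g : X → X} (hg : IsEpi g) :
    ∃ h : ℝ → ℝ, Continuous h ∧ Monotone h ∧ (∀ x : X, h x = g x) ∧
      (∀ y, ∃ x, h x < y) ∧ ∀ y, ∃ x, y < h x := by
  let A : ℝ → Set ℝ := fun x => (fun t : X => (g t : ℝ)) '' {t | (t : ℝ) ≤ x}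
  have hb : ∀ x, BddAbove (A x) := by
    intro x
    obtain ⟨u, hu, hxu⟩ := hX.exists_gt x
    refine ⟨g ⟨u, hu⟩, ?_⟩
    rintro _ ⟨t, ht, rfl⟩
    exact hg.1 (show (t : ℝ) ≤ u from le_trans ht hxu.le)
  have hn : ∀ x, (A x).Nonempty := by
    intro x
    obtain ⟨u, hu, hxu⟩ := hX.exists_lt x
    exact ⟨_, ⟨u, hu⟩, hxu.le, rfl⟩
  have hm : Monotone fun x => sSup (A x) := fun x y hxy =>
    csSup_le_csSup (hb y) (hn x) (image_mono fun t ht => le_trans ht hxy)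
  have hval : ∀ x : X, sSup (A x) = g x := fun x => by
    refine IsGreatest.csSup_eq ⟨⟨x, le_refl (x : ℝ), rfl⟩, ?_⟩
    rintro _ ⟨t, ht, rfl⟩
    exact hg.1 ht
  have hsub : ∀ v ∈ X, ∃ u, sSup (A u) = v := fun v hv => by
    obtain ⟨u, hu⟩ := hg.2 ⟨v, hv⟩
    exact ⟨u, by rw [hval, hu]⟩
  -- A monotone map with dense range has no jumps; the range contains `X` by surjectivity.
  refine ⟨fun x => sSup (A x), hm.continuous_of_denseRange (hX.mono hsub), hm, hval,
    fun y => ?_, fun y => ?_⟩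
  · obtain ⟨v, hv, hvy⟩ := hX.exists_lt y
    obtain ⟨u, hu⟩ := hsub v hv
    exact ⟨u, hu.trans_lt hvy⟩
  · obtain ⟨v, hv, hvy⟩ := hX.exists_gt y
    obtain ⟨u, hu⟩ := hsub v hv
    exact ⟨u, hvy.trans_eq hu.symm⟩

/-! ### Epimorphisms of `X` are generated from `collapse`. -/

theorem collapse_of_nonneg {x : ℝ} (hx : 0 ≤ x) : collapse x = max (x - 1) 0 := by
  unfold collapse
  split_ifs with h1 h2
  · rw [max_eq_right] <;> linarith
  · rw [max_eq_right]; linarith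
  · rw [max_eq_left]; linarith

theorem coe_iterate_of_nonneg {X : Set ℝ} {f : X → X} (hf : ∀ x : X, (f x : ℝ) = collapse x)
    (k : ℕ) {x : X} (hx : (0 : ℝ) ≤ x) : (f^[k] x : ℝ) = max ((x : ℝ) - k) 0 := by
  induction k with
  | zero => simp [hx]
  | succ k ih =>
    rw [Function.iterate_succ_apply', hf, ih, collapse_of_nonneg (le_max_right _ _)]
    push_cast
    rcases le_total ((x : ℝ) - k) 0 with h | h
    · rw [max_eq_right h, max_eq_right, max_eq_right] <;> linarith
    · rw [max_eq_left h, sub_sub]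

theorem isBackwardOrbit_natCast {X : Set ℝ} (hrat : ∀ q : ℚ, (q : ℝ) ∈ X) {f : X → X}
    (hf : ∀ x : X, (f x : ℝ) = collapse x) :
    IsBackwardOrbit f fun n : ℕ => (⟨n, by exact_mod_cast hrat n⟩ : X) := by
  refine ⟨fun m n hmn => ?_, fun n => Subtype.ext ?_⟩
  · exact Subtype.mk_lt_mk.2 (by exact_mod_cast hmn)
  · rw [hf, collapse_of_nonneg (by positivity)]
    simp

/-- An epimorphism of a dense saturated set which extends to a class-rigid continuous map is
generated from the restriction of `collapse`. -/
theorem generatedWide_of_extension {X : Set ℝ} (hX : Dense X)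
    (hsat : ∀ x y, rep x = rep y → x ∈ X → y ∈ X) (hrat : ∀ q : ℚ, (q : ℝ) ∈ X) {f g : X → X}
    (hf : ∀ x : X, (f x : ℝ) = collapse x) {h : ℝ → ℝ} (hr : IsClassRigid h)
    (hc : Continuous h) (hm : Monotone h) (hbot : ∀ y, ∃ x, h x < y) (htop : ∀ y, ∃ x, y < h x)
    (hg : ∀ x : X, h x = g x) : GeneratedWide f g := by
  have hneg : ∀ x ≤ 0, h x = x := fun x hx => hr.eq_self hc hm hbot htop hx
  have h0 : h 0 = 0 := hneg 0 le_rfl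
  have hnn : ∀ x, 0 ≤ x → 0 ≤ h x := fun x hx => h0 ▸ hm hx
  have hd := hr.monotone_sub hc hm
  obtain ⟨q, e, k, he0, hstep⟩ := hr.exists_breakpoints hc hm htop h0
  set s : ℕ → ℕ := fun n => ∑ i ∈ Finset.range n, k i with hs
  let grow : ℕ → Prop := fun n => ∃ x, e n - h (e n) < x - h x
  have hnat : ∀ n : ℕ, (n : ℝ) ∈ X := fun n => by exact_mod_cast hrat n
  have hiter : ∀ (x : X) (n : ℕ), (0 : ℝ) ≤ x → (x : ℝ) - h x = n → g x = f^[n] x := by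
    intro x n hx hn
    refine Subtype.ext ?_
    rw [coe_iterate_of_nonneg hf n hx, ← hg, ← hn, sub_sub_cancel, max_eq_left (hnn _ hx)]
  have hconst : ∀ x y : X, h x = h y → g x = g y := fun x y hxy =>
    Subtype.ext (by rw [← hg, ← hg, hxy])
  have he_nonneg : ∀ n, (∀ m < n, grow m) → 0 ≤ e n := by
    intro n
    induction n with
    | zero => exact fun _ => he0.ge
    | succ n ih =>
      intro hn
      have h1 := ih fun m hmn => hn m (by omega)
      obtain ⟨h2, -, -, h3, -⟩ := (hstep n fun m hmn => hn m (by omega)).2 (hn n (by omega))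
      rw [h3]
      have : (0 : ℝ) ≤ k n := by positivity
      linarith
  have hfacts : ∀ n, (∀ m ≤ n, grow m) → 0 ≤ q n ∧ q n < e (n + 1) ∧ q n ∈ X ∧
      e (n + 1) ∈ X ∧ e (n + 1) - k n = q n ∧ q n - h (q n) = s n ∧ 1 ≤ k n ∧
      (∀ x ∈ Icc (e n) (q n), x - h x = s n) ∧
      ∀ x ∈ Icc (q n) (e (n + 1)), h x = h (q n) := by
    intro n hn
    obtain ⟨h1, -, h3, h4, h5, h6⟩ := (hstep n fun m hmn => hn m hmn.le).2 (hn n le_rfl)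
    have hq : 0 ≤ q n := (he_nonneg n fun m hmn => hn m hmn.le).trans h1
    have hk : (1 : ℝ) ≤ k n := by exact_mod_cast h3
    have hlt : q n < e (n + 1) := by linarith
    have hqs : q n - h (q n) = s n := h5 _ ⟨h1, le_rfl⟩
    -- A point of `X` inside the constant piece puts the value `h (q n)` in `X`; `q n` and `e (n +
    -- 1)` differ from it by integers, so saturation puts them in `X` too.
    obtain ⟨x, hx, hqx, hxe⟩ := hX.exists_between hlt
    have hv : h (q n) ∈ X := by
      rw [← h6 x ⟨hqx.le, hxe.le⟩, hg ⟨x, hx⟩]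
      exact (g ⟨x, hx⟩).2
    have hqX : q n ∈ X :=
      hsat _ _ (rep_eq_rep_of_sub_eq (hnn _ hq) hq (s n) (by exact_mod_cast hqs)) hv
    refine ⟨hq, hlt, hqX, ?_, by linarith, hqs, h3, h5, h6⟩
    exact hsat _ _ (rep_eq_rep_of_sub_eq hq (by linarith) (k n) (by push_cast; linarith)) hqX
  let b : ℕ → ℝ := fun m => if Even m then q (m / 2) else e (m / 2 + 1)
  have hb0 : ∀ n, b (2 * n) = q n := fun n => by simp [b]
  have hb1 : ∀ n, b (2 * n + 1) = e (n + 1) := fun n => by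
    have : (2 * n + 1) / 2 = n := by omega
    simp [b, this]
  have hbX : ∀ n, (∀ m ≤ n, grow m) → b (2 * n) ∈ X ∧ b (2 * n + 1) ∈ X := fun n hn => by
    obtain ⟨-, -, h1, h2, -⟩ := hfacts n hn
    rw [hb0, hb1]
    exact ⟨h1, h2⟩
  classical
  -- The default 0 only fills indices past the last breakpoint, which the finite form ignores.
  let β : ℕ → X := fun m => if hm : b m ∈ X then ⟨b m, hm⟩ else ⟨(0 : ℕ), hnat 0⟩
  have hβ0 : ∀ n, (∀ m ≤ n, grow m) → (β (2 * n) : ℝ) = q n := fun n hn => by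
    simp only [β, dif_pos (hbX n hn).1, hb0]
  have hβ1 : ∀ n, (∀ m ≤ n, grow m) → (β (2 * n + 1) : ℝ) = e (n + 1) := fun n hn => by
    simp only [β, dif_pos (hbX n hn).2, hb1]
  have hβ_even : ∀ n, (∀ m ≤ n, grow m) → β (2 * n) < β (2 * n + 1) := fun n hn => by
    rw [← Subtype.coe_lt_coe, hβ0 n hn, hβ1 n hn]
    exact (hfacts n hn).2.1
  have hβ_odd : ∀ n, (∀ m ≤ n + 1, grow m) → β (2 * n + 1) < β (2 * n + 2) := fun n hn => by
    have := hβ0 (n + 1) hn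
    rw [← Subtype.coe_lt_coe, hβ1 n fun m hmn => hn m (by omega)]
    exact this ▸ ((hstep (n + 1) fun m hmn => hn m hmn.le).2 (hn _ le_rfl)).2.1 (by omega)
  have hβ_succ : ∀ i, (∀ m ≤ (i + 1) / 2, grow m) → β i < β (i + 1) := fun i hi => by
    obtain ⟨n, rfl | rfl⟩ := i.even_or_odd'
    · exact hβ_even n fun m hmn => hi m (by omega)
    · exact hβ_odd n fun m hmn => hi m (by omega)
  have hβ_nonneg : ∀ i, (0 : ℝ) ≤ β i ∨ ∃ m ≤ i / 2, ¬ grow m := fun i => by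
    by_cases hi : ∀ m ≤ i / 2, grow m
    · left
      obtain ⟨n, rfl | rfl⟩ := i.even_or_odd'
      · have hn : ∀ m ≤ n, grow m := fun m hmn => hi m (by omega)
        rw [hβ0 n hn]
        exact (hfacts n hn).1
      · have hn : ∀ m ≤ n, grow m := fun m hmn => hi m (by omega)
        rw [hβ1 n hn]
        exact (hfacts n hn).1.trans (hfacts n hn).2.1.le
    · push Not at hi
      exact Or.inr hi
  have hβ_iter : ∀ n, (∀ m ≤ n, grow m) →
      1 ≤ k n ∧ f^[k n] (β (2 * n + 1)) = β (2 * n) := fun n hn => by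
    obtain ⟨h1, h2, -, -, h3, -, h4, -⟩ := hfacts n hn
    refine ⟨h4, Subtype.ext ?_⟩
    have hβn : (0 : ℝ) ≤ β (2 * n + 1) := by rw [hβ1 n hn]; linarith
    rw [coe_iterate_of_nonneg hf _ hβn, hβ1 n hn, hβ0 n hn, h3, max_eq_left h1]
  have hβ_val : ∀ n, (∀ m ≤ n, grow m) → g (β (2 * n)) = f^[s n] (β (2 * n)) := fun n hn => by
    have h1 := hfacts n hn
    refine hiter _ _ ?_ ?_
    · rw [hβ0 n hn]; exact h1.1
    · rw [hβ0 n hn]; exact h1.2.2.2.2.2.1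
  have hflat : ∀ n, (∀ m ≤ n, grow m) → ∀ x ∈ Icc (β (2 * n)) (β (2 * n + 1)),
      g x = f^[s n] (β (2 * n)) := fun n hn x hx => by
    rw [← hβ_val n hn]
    refine hconst _ _ ?_
    rw [hβ0 n hn]
    refine (hfacts n hn).2.2.2.2.2.2.2.2 x ⟨?_, ?_⟩
    · rw [← hβ0 n hn]; exact hx.1
    · rw [← hβ1 n hn]; exact hx.2
  have hslope : ∀ n, (∀ m ≤ n + 1, grow m) → ∀ x ∈ Icc (β (2 * n + 1)) (β (2 * n + 2)),
      g x = f^[s (n + 1)] x := fun n hn x hx => by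
    have hn' : ∀ m ≤ n, grow m := fun m hmn => hn m (by omega)
    have hx1 : e (n + 1) ≤ x := by rw [← hβ1 n hn']; exact hx.1
    refine hiter _ _ ((he_nonneg (n + 1) fun m hmn => hn m hmn.le).trans hx1) ?_
    refine (hfacts (n + 1) hn).2.2.2.2.2.2.2.1 x ⟨hx1, ?_⟩
    rw [← hβ0 (n + 1) hn]
    exact hx.2
  have hfix : grow 0 → ∀ x : X, x < β 0 → g x = x := fun hgr x hx => by
    have hn : ∀ m ≤ 0, grow m := fun m hm0 => by rwa [Nat.le_zero.1 hm0]
    refine Subtype.ext ?_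
    rw [← hg]
    rcases le_total (x : ℝ) 0 with hx0 | hx0
    · exact hneg _ hx0
    · have hxq : (x : ℝ) ≤ q 0 := by rw [← hβ0 0 hn]; exact hx.le
      have := (hfacts 0 hn).2.2.2.2.2.2.2.1 x ⟨he0.trans_le hx0, hxq⟩
      simp only [hs, Finset.range_zero, Finset.sum_empty, Nat.cast_zero] at this
      linarith
  have hcof : ∀ x : X, ∃ m : ℕ, x < (⟨m, hnat m⟩ : X) := fun x => exists_nat_gt (x : ℝ)
  refine ⟨_, isBackwardOrbit_natCast hrat hf, ?_⟩
  -- The infinite form arises when the drop grows without end, the finite form when it stabilizes at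
  -- a first `e N`.
  by_cases hall : ∀ n, grow n
  · have hall' : ∀ n, ∀ m ≤ n, grow m := fun n m _ => hall m
    have hmono : StrictMono β := strictMono_nat_of_lt_succ fun i => hβ_succ i fun m _ => hall m
    -- Every `k i ≥ 1`, so the breakpoints tend to infinity and the pieces exhaust `[b 0, ∞)`.
    have hq_ge : ∀ n : ℕ, (n : ℝ) ≤ q n := fun n => by
      have h1 := hfacts n (hall' n)
      have h2 := hnn _ h1.1
      have h3 : n ≤ s n := by
        simpa using Finset.card_nsmul_le_sum (Finset.range n) k 1 fun i _ => (hβ_iter i (hall' i)).1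
      have h4 : (n : ℝ) ≤ s n := by exact_mod_cast h3
      linarith [h1.2.2.2.2.2.1]
    refine Or.inl ⟨β, k, hmono, fun n => ⟨?_, hcof _⟩, fun n => hβ_iter n (hall' n),
      fun m => ?_, fun x hx => ?_, fun n => hflat n (hall' n), fun n => hslope n (hall' (n + 1))⟩
    · rcases hβ_nonneg n with h1 | ⟨m, -, h1⟩
      · exact Subtype.coe_le_coe.1 (by simpa using h1)
      · exact (h1 (hall m)).elim
    · obtain ⟨y, hy⟩ := htop m
      obtain ⟨n, hn⟩ := exists_nat_ge y
      refine ⟨n, ?_⟩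
      rw [← hβ_val n (hall' n), ← Subtype.coe_le_coe, ← hg, hβ0 n (hall' n)]
      exact hy.le.trans (hm (hn.trans (hq_ge n)))
    · refine hfix (hall 0) x (lt_of_not_ge fun hge => ?_)
      have hle : ∀ n, β n ≤ x := fun n => by
        induction n with
        | zero => exact hge
        | succ n ih => exact le_of_not_ge fun h' => hx n ⟨ih, h'⟩
      obtain ⟨n, hn⟩ := exists_nat_gt (x : ℝ)
      have h1 : (β (2 * n) : ℝ) ≤ x := hle (2 * n)
      rw [hβ0 n (hall' n)] at h1
      linarith [hq_ge n]
  · push Not at hall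
    obtain ⟨hN, hlt⟩ := And.intro (Nat.find_spec hall) fun m (h' : m < Nat.find hall) =>
      not_not.1 (Nat.find_min hall h')
    generalize Nat.find hall = N at hN hlt
    have hlast : ∀ x, e N ≤ x → x - h x = s N := fun x hx => by
      have h1 : e N - h (e N) = s N := (hstep N hlt).1
      refine le_antisymm ?_ (h1 ▸ hd hx)
      rw [← h1]
      exact le_of_not_gt fun h' => hN ⟨x, h'⟩
    have hsuccN : ∀ i, i + 1 < 2 * N → β i < β (i + 1) := fun i hi =>
      hβ_succ i fun m hmi => hlt m (by omega)
    refine Or.inr ⟨N, β, k, fun i j hij => ?_, fun n hn => ⟨?_, hcof _⟩,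
      fun n hn => hβ_iter n fun m hmn => hlt m (by omega), fun x hx => ?_, fun n hn x hx => ?_,
      fun n hn x hx => ?_⟩
    · induction j, hij using Nat.le_induction with
      | base => exact hsuccN i
      | succ j hij ih => exact fun hj => (ih (by omega)).trans (hsuccN j hj)
    · rcases hβ_nonneg n with h1 | ⟨m, hmn, h1⟩
      · exact Subtype.coe_le_coe.1 (by simpa using h1)
      · exact (h1 (hlt m (by omega))).elim
    · rcases N.eq_zero_or_pos with rfl | hpos
      · refine Subtype.ext ?_
        rw [← hg]
        rcases le_total (x : ℝ) 0 with hx0 | hx0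
        · exact hneg _ hx0
        · have := hlast x (he0.trans_le hx0)
          simp only [hs, Finset.range_zero, Finset.sum_empty, Nat.cast_zero] at this
          linarith
      · refine hfix (hlt 0 hpos) x (lt_of_not_ge fun hge => ?_)
        have hle : ∀ n, n < 2 * N → β n ≤ x := fun n => by
          induction n with
          | zero => exact fun _ => hge
          | succ n ih =>
            intro hn
            refine le_of_not_ge fun h' => hx n (by omega) ⟨ih (by omega), ?_⟩
            rwa [if_pos hn]
        refine hx (2 * N - 1) (by omega) ⟨hle _ (by omega), ?_⟩
        rw [if_neg (by omega)]
        exact hcof x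
    · obtain ⟨h1, h2⟩ := hx
      rw [if_pos (by omega)] at h2
      exact hflat n (fun m hmn => hlt m (by omega)) x ⟨h1, h2⟩
    · obtain ⟨h1, h2⟩ := hx
      split_ifs at h2 with hn'
      · exact hslope n (fun m hmn => hlt m (by omega)) x ⟨h1, h2⟩
      · obtain rfl : N = n + 1 := by omega
        have hx1 : e (n + 1) ≤ x := by
          rw [← hβ1 n fun m hmn => hlt m (by omega)]
          exact h1
        exact hiter x _ ((he_nonneg _ hlt).trans hx1) (hlast x hx1)

/-! ### Automorphism rigidity and conclusion. -/

theorem dense_of_ratCast_mem {X : Set ℝ} (hrat : ∀ q : ℚ, (q : ℝ) ∈ X) : Dense X :=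
  Rat.isDenseEmbedding_coe_real.dense.mono (range_subset_iff.2 hrat)

/-- A positive drop somewhere would create a constant piece of length at least 1; by density it
contains two points of `X`, against injectivity. -/
theorem autRigid_of_isClassRigid {X : Set ℝ} (hX : Dense X)
    (hr : ∀ h : ℝ → ℝ, Continuous h → (∀ x ∈ X, h x ∈ X) → IsClassRigid h) : AutRigid X := by
  intro φ
  obtain ⟨h, hc, hm, hg, hbot, htop⟩ := exists_continuous_extension hX
    (g := φ) ⟨φ.monotone, φ.surjective⟩
  have hr := hr h hc fun x hx => by rw [hg ⟨x, hx⟩]; exact (φ _).2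
  have hle : ∀ x, x ≤ h x := by
    by_contra hex
    push Not at hex
    obtain ⟨x, hx⟩ := hex
    obtain ⟨q, j, -, hj, -, hqj, -⟩ := hr.exists_step hc hm htop (p := 0) (k := 0)
      (by simp [hr.eq_self hc hm hbot htop le_rfl]) ⟨x, by simpa using hx⟩
    have hj : (1 : ℝ) ≤ j := by exact_mod_cast hj
    obtain ⟨u, hu, hqu, huj⟩ := hX.exists_between (show q < q + j by linarith)
    obtain ⟨v, hv, huv, hvj⟩ := hX.exists_between huj
    have huv' : φ ⟨u, hu⟩ < φ ⟨v, hv⟩ := φ.strictMono huv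
    rw [← Subtype.coe_lt_coe, ← hg, ← hg] at huv'
    have h1 := hm hqu.le
    have h2 := hm hvj.le
    dsimp only at huv'
    linarith
  ext x
  rw [← hg]
  exact le_antisymm (hr.le_self hc hm hbot x) (hle x)

end SurjRigid

theorem theorem3p2 :
    ∃ X : Set ℝ, Dense X ∧ SurjRigid.AutRigid X ∧ Cardinal.mk X = Cardinal.continuum ∧
      ∃ f : X → X, (∀ x : X, (f x : ℝ) = SurjRigid.collapse x) ∧
        SurjRigid.IsEpi f ∧ f ≠ id ∧
        ∀ g : X → X, SurjRigid.IsEpi g → SurjRigid.GeneratedWide f g := by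
  obtain ⟨X, hsat, hrat, hcard, hr⟩ := SurjRigid.exists_rigid_set
  have hX := SurjRigid.dense_of_ratCast_mem hrat
  have h0 : (0 : ℝ) ∈ X := by exact_mod_cast hrat 0
  have h1 : (1 : ℝ) ∈ X := by exact_mod_cast hrat 1
  have hmem : ∀ x ∈ X, SurjRigid.collapse x ∈ X := fun x hx => by
    -- `collapse` changes the class only when it sends a point of `[0, 1]` to 0, and 0 is in `X`.
    rcases SurjRigid.rep_collapse x with h | ⟨-, -, h⟩
    · exact hsat _ _ h.symm hx
    · rwa [h]
  refine ⟨X, hX, SurjRigid.autRigid_of_isClassRigid hX hr, hcard,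
    fun x => ⟨SurjRigid.collapse x, hmem x x.2⟩, fun x => rfl, ⟨fun x y hxy => ?_, fun y => ?_⟩,
    fun hid => ?_, fun g hg => ?_⟩
  · have hxy : (x : ℝ) ≤ y := hxy
    rw [Subtype.mk_le_mk]
    unfold SurjRigid.collapse
    split_ifs <;> linarith
  · rcases le_total (y : ℝ) 0 with hy | hy
    · exact ⟨y, Subtype.ext (if_pos hy)⟩
    · refine ⟨⟨y + 1, hsat y _ (SurjRigid.rep_eq_rep_of_sub_eq hy (by linarith) 1
        (by push_cast; ring)) y.2⟩, Subtype.ext ?_⟩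
      simp [SurjRigid.collapse_of_nonneg (show (0 : ℝ) ≤ y + 1 by linarith), hy]
  · have := congrArg Subtype.val (congrFun hid ⟨1, h1⟩)
    simp [SurjRigid.collapse] at this
  · obtain ⟨h, hc, hm, hval, hbot, htop⟩ := SurjRigid.exists_continuous_extension hX hg
    have hrig := hr h hc fun x hx => by rw [hval ⟨x, hx⟩]; exact (g _).2
    exact SurjRigid.generatedWide_of_extension hX hsat hrat (fun x => rfl) hrig hc hm hbot htop hval
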